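/- Let $\omega\subset\mathbb{R}^2$ be a bounded domain, let $\omega_0$ be an open set with $0\in\omega_0$ and $\overline{\omega_0}\subset\omega$, and let $0<\kappa_-\le\kappa_+$, $0<\gamma_-\le\gamma_+$, $\lambda>0$. For $\varepsilon>0$ let $r_\varepsilon>0$ and $\alpha_\varepsilon$ be such that $$\kappa_-\le\alpha_\varepsilon\,\pi r_\varepsilon^2\le\kappa_+,\qquad \frac{2\pi}{\gamma_+}\le-\varepsilon^2\ln r_\varepsilon\le\frac{2\pi}{\gamma_-}.$$ Let $D_{m,n,\varepsilon}$ be the disc of radius $\varepsilon r_\varepsilon$ centred at $(m\varepsilon,n\varepsilon)$, $(m,n)\in\mathbb{Z}^2$, let $D_\varepsilon$ be the union of those discs $D_{m,n,\varepsilon}$ that are contained in $\omega_0$, and let $a_\varepsilon=\alpha_\varepsilon$ in $D_\varepsilon$ and $a_\varepsilon=1$ in $\omega\setminus D_\varepsilon$. Set $f_\varepsilon=\varepsilon^{-1}\mathbf{1}_{D_{0,0,\varepsilon}}$, and let $\varphi_\varepsilon\in H^1_0(\omega)$ be the weak solution of $$-\operatorname{div}(a_\varepsilon\nabla\varphi_\varepsilon)+\lambda\,a_\varepsilon\,\varphi_\varepsilon=a_\varepsilon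 f_\varepsilon\quad\text{in }\omega .$$ Then: (i) $\|\sqrt{a_\varepsilon}f_\varepsilon\|_{L^2(\omega)}\le\sqrt{\kappa_+}$ for every $\varepsilon>0$ such that $D_{0,0,\varepsilon}\subset\omega_0$ (in particular for all small $\varepsilon$). (ii) There is a function $o(1)$ of $\varepsilon$ with $\lim_{\varepsilon\to0}o(1)=0$, which depends only on $\omega,\omega_0,\kappa_\pm,\gamma_\pm,\lambda$ (and not on the choice of $r_\varepsilon$, $\alpha_\varepsilon$), such that for all sufficiently small $\varepsilon>0$, with a threshold that depends on the same data only, $$\|\varphi_\varepsilon\|_{L^\infty(\omega)}\ \ge\ \frac1\varepsilon\,\frac{\kappa_-}{\kappa_+}\,\frac{\kappa_-}{\gamma_++\lambda\kappa_++o(1)} .$$ (iii) Consequently the $\varepsilon$-dependence in the supremum estimate cannot be better than $\varepsilon^{-1}$: there is a constant $c>0$ independent of $\varepsilon$, $r_\varepsilon$, $\alpha_\varepsilon$ such that, for all sufficiently small $\varepsilon>0$, every real $K$ with $\|\varphi_\varepsilon\|_{L^\infty(\omega)}\le K\,\|\sqrt{a_\varepsilon}f_\varepsilon\|_{L^2(\omega)}$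 satisfies $K\ge c/\varepsilon$. -/

import Mathlib

open MeasureTheory Filter Topology

namespace FibredMedium

/-- The Euclidean plane `ℝ²`. -/
abbrev Plane := EuclideanSpace ℝ (Fin 2)

/-- The open disc `D_{m,n,ε}` of radius `ε r` centred at `(m ε, n ε)`. -/
def disc (ε r : ℝ) (m n : ℤ) : Set Plane :=
  Metric.ball (!₂[(m : ℝ) * ε, (n : ℝ) * ε] : Plane) (ε * r)

/-- The indices `(m, n)` for which the disc `D_{m,n,ε}` is contained in `ω₀`. -/
def indexSet (ω₀ : Set Plane) (ε r : ℝ) : Set (ℤ × ℤ) :=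
  {p | disc ε r p.1 p.2 ⊆ ω₀}

/-- The cross section `D_ε` of the fibres: the union of the discs contained in `ω₀`. -/
def fibres (ω₀ : Set Plane) (ε r : ℝ) : Set Plane :=
  ⋃ p ∈ indexSet ω₀ ε r, disc ε r p.1 p.2

open Classical in
/-- The conductivity `a_ε`: equal to `α` in the fibres and to `1` elsewhere. -/
noncomputable def conductivity (ω₀ : Set Plane) (ε r α : ℝ) (x : Plane) : ℝ :=
  if x ∈ fibres ω₀ ε r then α else 1

/-- The source term `f_ε = ε⁻¹ 1_{D_{0,0,ε}}`. -/
noncomputable def source (ε r : ℝ) : Plane → ℝ :=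
  (disc ε r 0 0).indicator (fun _ => ε⁻¹)

/-- The test functions `C_c^∞(ω)`. -/
structure IsTestFunction (ω : Set Plane) (v : Plane → ℝ) : Prop where
  smooth : ContDiff ℝ (⊤ : ℕ∞) v
  hasCompactSupport : HasCompactSupport v
  tsupport_subset : tsupport v ⊆ ω

/-- `u` belongs to `H¹₀(ω)`, the closure of `C_c^∞(ω)` in `H¹(ω)`, and its weak gradient
is `G`: there are test functions `ψ n` with `ψ n → u` and `∇ (ψ n) → G` in `L²(ω)`. -/
structure IsH10WithGradient (ω : Set Plane) (u : Plane → ℝ) (G : Plane → Plane) : Prop where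
  memLp : MemLp u 2 (volume.restrict ω)
  memLp_gradient : MemLp G 2 (volume.restrict ω)
  approx : ∃ ψ : ℕ → Plane → ℝ, (∀ n, IsTestFunction ω (ψ n)) ∧
    Tendsto (fun n => eLpNorm (fun x => ψ n x - u x) 2 (volume.restrict ω)) atTop (𝓝 0) ∧
    Tendsto (fun n => eLpNorm (fun x => gradient (ψ n) x - G x) 2 (volume.restrict ω))
      atTop (𝓝 0)

/-- `u ∈ H¹₀(ω)` is a weak solution of `-div (a ∇u) + lam a u = a f + div (a h)` in `ω`. -/
def IsWeakSolution (ω : Set Plane) (a : Plane → ℝ) (lam : ℝ) (f : Plane → ℝ)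
    (h : Plane → Plane) (u : Plane → ℝ) : Prop :=
  ∃ G : Plane → Plane, IsH10WithGradient ω u G ∧
    ∀ v : Plane → ℝ, IsTestFunction ω v →
      ∫ x in ω, (a x * inner ℝ (G x) (gradient v x) + lam * a x * u x * v x) =
        ∫ x in ω, (a x * f x * v x - a x * inner ℝ (h x) (gradient v x))

/-- The standing bounds on the radius parameter `r` and the conductivity `α` at scale `ε`:
`κ₋ ≤ α π r² ≤ κ₊` and `2π/γ₊ ≤ -ε² ln r ≤ 2π/γ₋`. -/
structure Admissible (κm κp γm γp ε r α : ℝ) : Prop where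
  r_pos : 0 < r
  kappa_le : κm ≤ α * (Real.pi * r ^ 2)
  le_kappa : α * (Real.pi * r ^ 2) ≤ κp
  gamma_le : 2 * Real.pi / γp ≤ -(ε ^ 2 * Real.log r)
  le_gamma : -(ε ^ 2 * Real.log r) ≤ 2 * Real.pi / γm

end FibredMedium

/-!
The bilinear form `B(u, v) = ∫ a (∇u · ∇v + lam u v)` of the equation is symmetric and nonnegative, so
the energy `B(φ, φ) = ∫ a f φ` of the solution satisfies `(∫ a f v)² ≤ B(φ, φ) B(v, v)` for every test
function `v` (`IsWeakSolution.energy_lower_bound`). The source is `ε⁻¹` on the central disc `D` of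
radius `ε r` and vanishes elsewhere. With `S = α π r²`, the energy of the solution is therefore at most
`ε S ‖φ‖_∞` (`setIntegral_conductivity_mul_source_le`), and `∫ a f v = ε S` as soon as `v = 1` on `D`
(`setIntegral_conductivity_mul_source`). Hence `‖φ‖_∞ ≥ ε S / B(v, v)`, and what is needed is a test
function that is `1` on `D` and has the least possible energy.

Such a `v` is the capacitary potential of `D` in the concentric disc of radius `ε²`, smoothed on the
logarithmic scale (`exists_log_cutoff`). Other discs are too far away to matter, so the gradient term is
the capacity `2π / L` of the annulus up to a factor tending to `1`, where `L = log ε - log r`; it is at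
most `ε² (γ₊ + o(1))` because `ε² L ≥ 2π / γ₊ + ε² log ε`. The mass term is `lam ε² S` on `D` and at most
`lam π ε⁴` on the annulus (`exists_testFunction_energy_le`). The total is
`ε² (γ₊ + lam κ₊ + o(1))`, which yields the lower bound
(`IsWeakSolution.le_eLpNorm_top`, `tendsto_energyError`, `eventually_le_eLpNorm_top`). Together with the
bound `√κ₊` on the norm of the source (`eLpNorm_source_le`) it gives the optimality of the factor `1 / ε`.
-/

namespace FibredMedium

/-! ### Smooth logarithmic cutoffs -/

/-- A smooth decreasing step from `1` to `0` on `[s₀, s₁]` whose slope is that of the affine step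
up to the loss of a constant length `2`. It is `1` minus the normalized primitive of a bump function
that equals `1` on `[s₀ + 1, s₁ - 1]` and vanishes outside `[s₀, s₁]`. -/
theorem exists_smooth_step {s₀ s₁ : ℝ} (h : s₀ + 2 < s₁) :
    ∃ η : ℝ → ℝ, ContDiff ℝ (⊤ : ℕ∞) η ∧ (∀ s ≤ s₀, η s = 1) ∧ (∀ s, s₁ ≤ s → η s = 0) ∧
      (∀ s, η s ∈ Set.Icc 0 1) ∧ ∀ s, |deriv η s| ≤ 1 / (s₁ - s₀ - 2) := by
  let g : ContDiffBump ((s₀ + s₁) / 2) :=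
    ⟨(s₁ - s₀) / 2 - 1, (s₁ - s₀) / 2, by linarith, by linarith⟩
  have hg0 : ∀ t, t ∉ Set.Ioo s₀ s₁ → g t = 0 := by
    intro t ht
    apply g.zero_of_le_dist
    change (s₁ - s₀) / 2 ≤ _
    rw [Real.dist_eq]
    by_contra! hlt
    rw [abs_lt] at hlt
    exact ht ⟨by linarith, by linarith⟩
  have hgc : Continuous g := g.continuous
  have hgi : ∀ a b, IntervalIntegrable g volume a b := fun a b => hgc.intervalIntegrable a b
  set I := ∫ t, g t with hI
  have hIge : s₁ - s₀ - 2 ≤ I := by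
    have := g.measure_closedBall_le_integral volume
    rw [measureReal_def, Real.volume_closedBall, ENNReal.toReal_ofReal] at this
    · change 2 * ((s₁ - s₀) / 2 - 1) ≤ I at this
      linarith
    · change 0 ≤ 2 * ((s₁ - s₀) / 2 - 1)
      linarith
  have hIpos : 0 < I := by linarith
  have hIeq : ∀ s, s₁ ≤ s → ∫ t in s₀..s, g t = I := by
    intro s hs
    rw [intervalIntegral.integral_of_le (by linarith), hI]
    apply setIntegral_eq_integral_of_forall_compl_eq_zero
    intro t ht
    apply hg0
    exact fun h' => ht ⟨h'.1, h'.2.le.trans hs⟩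
  have hderiv : ∀ s, HasDerivAt (fun s => 1 - (∫ t in s₀..s, g t) / I) (-(g s / I)) s := by
    intro s
    exact ((intervalIntegral.integral_hasDerivAt_right (hgi _ _)
      (hgc.stronglyMeasurableAtFilter _ _) hgc.continuousAt).div_const I).const_sub 1
  have hone : ∀ s ≤ s₀, 1 - (∫ t in s₀..s, g t) / I = 1 := by
    intro s hs
    have : ∫ t in s₀..s, g t = 0 := by
      rw [intervalIntegral.integral_symm, intervalIntegral.integral_of_le hs,
        setIntegral_eq_zero_of_forall_eq_zero, neg_zero]
      intro t ht
      exact hg0 t fun h' => absurd ht.2 (not_le.2 h'.1)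
    simp [this]
  have hzero : ∀ s, s₁ ≤ s → 1 - (∫ t in s₀..s, g t) / I = 0 := by
    intro s hs
    rw [hIeq s hs, div_self hIpos.ne', sub_self]
  have hanti : Antitone (fun s => 1 - (∫ t in s₀..s, g t) / I) := by
    apply antitone_of_deriv_nonpos fun s => (hderiv s).differentiableAt
    intro s
    rw [(hderiv s).deriv]
    have := div_nonneg (g.nonneg' s) hIpos.le
    linarith
  refine ⟨fun s => 1 - (∫ t in s₀..s, g t) / I, ?_, hone, hzero, ?_, ?_⟩
  · rw [contDiff_infty_iff_deriv]
    refine ⟨fun s => (hderiv s).differentiableAt, ?_⟩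
    rw [show deriv (fun s => 1 - (∫ t in s₀..s, g t) / I) = fun s => -(g s / I) from
      funext fun s => (hderiv s).deriv]
    exact (g.contDiff.div_const I).neg
  · intro s
    constructor
    · have := hanti (le_max_left s s₁)
      simp only [hzero _ (le_max_right s s₁)] at this
      exact this
    · have := hanti (min_le_left s s₀)
      simp only [hone _ (min_le_right s s₀)] at this
      exact this
  · intro s
    rw [(hderiv s).deriv, abs_neg, abs_of_nonneg (div_nonneg (g.nonneg' s) hIpos.le)]
    exact div_le_div₀ zero_le_one g.le_one (by linarith) hIge

/-- A smoothed version of the capacitary potential of the annulus `ρ ≤ ‖x‖ ≤ R`: a smooth step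
evaluated at `log ‖x‖`. -/
theorem exists_log_cutoff {ρ R : ℝ} (hρ : 0 < ρ) (hL : Real.log ρ + 2 < Real.log R) (hR : 0 < R) :
    ∃ v : Plane → ℝ, ContDiff ℝ (⊤ : ℕ∞) v ∧ (∀ x, ‖x‖ < ρ → v x = 1) ∧
      (∀ x, R ≤ ‖x‖ → v x = 0) ∧ (∀ x, v x ∈ Set.Icc 0 1) ∧
      (∀ x, ‖x‖ < ρ → gradient v x = 0) ∧ (∀ x, R < ‖x‖ → gradient v x = 0) ∧
      ∀ x, x ≠ 0 → ‖gradient v x‖ ≤ 1 / ((Real.log R - Real.log ρ - 2) * ‖x‖) := by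
  obtain ⟨η, hη, h1, h0, hI, hd⟩ := exists_smooth_step hL
  classical
  -- The origin needs its own clause because `Real.log 0 = 0` is not `-∞`.
  let v : Plane → ℝ := fun x => if x = 0 then 1 else η (Real.log ‖x‖)
  have hvne : ∀ x, x ≠ 0 → v =ᶠ[𝓝 x] fun y => η (Real.log ‖y‖) := by
    intro x hx
    filter_upwards [isOpen_ne.mem_nhds hx] with y hy
    exact if_neg hy
  have hv1 : ∀ x, ‖x‖ < ρ → v x = 1 := by
    intro x hx
    by_cases hx0 : x = 0
    · exact if_pos hx0
    · simp only [v, if_neg hx0]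
      exact h1 _ (Real.log_le_log (norm_pos_iff.2 hx0) hx.le)
  have hv0 : ∀ x, R ≤ ‖x‖ → v x = 0 := by
    intro x hx
    have hx0 : x ≠ 0 := norm_pos_iff.1 (hR.trans_le hx)
    simp only [v, if_neg hx0]
    exact h0 _ (Real.log_le_log hR hx)
  have hv1' : ∀ x, ‖x‖ < ρ → v =ᶠ[𝓝 x] fun _ => 1 := by
    intro x hx
    filter_upwards [(isOpen_lt continuous_norm continuous_const).mem_nhds hx] with y hy
    exact hv1 y hy
  refine ⟨v, ?_, hv1, hv0, ?_, ?_, ?_, ?_⟩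
  · rw [contDiff_iff_contDiffAt]
    intro x
    by_cases hx : x = 0
    · refine ContDiffAt.congr_of_eventuallyEq contDiffAt_const (hv1' x ?_)
      simpa [hx] using hρ
    · refine ContDiffAt.congr_of_eventuallyEq ?_ (hvne x hx)
      exact hη.contDiffAt.comp x ((contDiffAt_norm ℝ hx).log (norm_ne_zero_iff.2 hx))
  · intro x
    by_cases hx : x = 0
    · simp [v, hx]
    · simp only [v, if_neg hx]
      exact hI _
  · intro x hx
    rw [(hv1' x hx).gradient_eq, gradient_fun_const]
  · intro x hx
    have : v =ᶠ[𝓝 x] fun _ => 0 := by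
      filter_upwards [(isOpen_lt continuous_const continuous_norm).mem_nhds hx] with y hy
      exact hv0 y (le_of_lt hy)
    rw [this.gradient_eq, gradient_fun_const]
  · intro x hx
    have hxn : 0 < ‖x‖ := norm_pos_iff.2 hx
    rw [(hvne x hx).gradient_eq, gradient, LinearIsometryEquiv.norm_map]
    have hdn : HasFDerivAt (fun y : Plane => ‖y‖) (fderiv ℝ (fun y : Plane => ‖y‖) x) x :=
      ((contDiffAt_norm ℝ hx).differentiableAt (n := 1) one_ne_zero).hasFDerivAt
    have hcomp : HasDerivAt (fun t => η (Real.log t))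
        (deriv η (Real.log ‖x‖) * (‖x‖)⁻¹) ‖x‖ :=
      HasDerivAt.comp ‖x‖ ((hη.differentiable (by simp)) _).hasDerivAt
        (Real.hasDerivAt_log hxn.ne')
    have := (hcomp.comp_hasFDerivAt x hdn).fderiv
    rw [Function.comp_def] at this
    rw [this, norm_smul, Real.norm_eq_abs, abs_mul, abs_of_pos (inv_pos.2 hxn), one_div, mul_inv]
    have h2 : ‖fderiv ℝ (fun y : Plane => ‖y‖) x‖ ≤ 1 := by
      simpa using norm_fderiv_le_of_lipschitz ℝ (lipschitzWith_one_norm (E := Plane)) (x₀ := x)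
    have h3 := hd (Real.log ‖x‖)
    rw [one_div] at h3
    calc _ ≤ |deriv η (Real.log ‖x‖)| * ‖x‖⁻¹ * 1 := by gcongr
      _ ≤ _ := by rw [mul_one]; gcongr

/-! ### The weight of an annulus -/

/-- In polar coordinates the integral of `‖x‖⁻²` over an annulus is `2π ∫ dt / t`. -/
theorem integral_annulus_inv_norm_sq {ρ R : ℝ} (hρ : 0 < ρ) (hR : ρ ≤ R) :
    Integrable ({x : Plane | ‖x‖ ∈ Set.Icc ρ R}.indicator fun x => (‖x‖ ^ 2)⁻¹) ∧
    ∫ x, {x : Plane | ‖x‖ ∈ Set.Icc ρ R}.indicator (fun x => (‖x‖ ^ 2)⁻¹) x =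
      2 * Real.pi * (Real.log R - Real.log ρ) := by
  let f : ℝ → ℝ := (Set.Icc ρ R).indicator fun y => (y ^ 2)⁻¹
  have hf : ({x : Plane | ‖x‖ ∈ Set.Icc ρ R}.indicator fun x => (‖x‖ ^ 2)⁻¹) =
      fun x => f ‖x‖ := by
    ext x
    simp [f, Set.indicator]
  have hg : (fun y : ℝ => y ^ (Module.finrank ℝ Plane - 1) • f y) =
      (Set.Icc ρ R).indicator fun y => y⁻¹ := by
    ext y
    by_cases hy : y ∈ Set.Icc ρ R
    · have : y ≠ 0 := (hρ.trans_le hy.1).ne'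
      simp only [f, Set.indicator_of_mem hy, finrank_euclideanSpace, Fintype.card_fin]
      simp only [smul_eq_mul, Nat.add_one_sub_one, pow_one]
      field_simp
    · simp [f, Set.indicator_of_notMem hy]
  have hsub : Set.Icc ρ R ⊆ Set.Ioi 0 := fun y hy => hρ.trans_le hy.1
  rw [hf]
  constructor
  · rw [integrable_fun_norm_addHaar volume, hg]
    apply Integrable.integrableOn
    rw [integrable_indicator_iff measurableSet_Icc]
    apply ContinuousOn.integrableOn_Icc
    exact continuousOn_id.inv₀ fun y hy => (hρ.trans_le hy.1).ne'
  · rw [integral_fun_norm_addHaar volume f, hg, setIntegral_indicator measurableSet_Icc,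
      Set.inter_eq_self_of_subset_right hsub, integral_Icc_eq_integral_Ioc,
      ← intervalIntegral.integral_of_le hR, integral_inv_of_pos hρ (hρ.trans_le hR),
      measureReal_def, EuclideanSpace.volume_ball_fin_two,
      Real.log_div (hρ.trans_le hR).ne' hρ.ne']
    simp [ENNReal.toReal_ofReal Real.pi_pos.le]
    ring

/-! ### Pairings in `L²` -/

/-- The Cauchy–Schwarz inequality in `L²`, as a bound on the `L¹` seminorm of the pointwise inner
product. -/
theorem eLpNorm_inner_le {α E : Type*} [MeasurableSpace α] {μ : Measure α}
    [NormedAddCommGroup E] [InnerProductSpace ℝ E] {f g : α → E}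
    (hf : AEStronglyMeasurable f μ) (hg : AEStronglyMeasurable g μ) :
    eLpNorm (fun x => (inner ℝ (f x) (g x) : ℝ)) 1 μ ≤ eLpNorm f 2 μ * eLpNorm g 2 μ := by
  have hle : ∀ᵐ x ∂μ, ‖(inner ℝ (f x) (g x) : ℝ)‖₊ ≤ 1 * ‖f x‖₊ * ‖g x‖₊ :=
    Eventually.of_forall fun x => by simpa using nnnorm_inner_le_nnnorm (𝕜 := ℝ) (f x) (g x)
  have := eLpNorm_le_eLpNorm_mul_eLpNorm_of_nnnorm (p := 2) (q := 2) (r := 1) hf hg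
    (fun a b : E => (inner ℝ a b : ℝ)) 1 hle
  rwa [ENNReal.coe_one, one_mul] at this

theorem integrable_inner_of_memLp {α E : Type*} [MeasurableSpace α] {μ : Measure α}
    [NormedAddCommGroup E] [InnerProductSpace ℝ E] {f g : α → E}
    (hf : MemLp f 2 μ) (hg : MemLp g 2 μ) : Integrable (fun x => inner ℝ (f x) (g x)) μ := by
  rw [← memLp_one_iff_integrable]
  exact ⟨hf.1.inner hg.1, (eLpNorm_inner_le hf.1 hg.1).trans_lt (ENNReal.mul_lt_top hf.2 hg.2)⟩

theorem tendsto_integral_inner {α E : Type*} [MeasurableSpace α] {μ : Measure α}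
    [NormedAddCommGroup E] [InnerProductSpace ℝ E] {f g : α → E} {h : ℕ → α → E}
    (hf : MemLp f 2 μ) (hg : MemLp g 2 μ) (hh : ∀ n, MemLp (h n) 2 μ)
    (hlim : Tendsto (fun n => eLpNorm (fun x => h n x - g x) 2 μ) atTop (𝓝 0)) :
    Tendsto (fun n => ∫ x, inner ℝ (f x) (h n x) ∂μ) atTop (𝓝 (∫ x, inner ℝ (f x) (g x) ∂μ)) := by
  have hz : Tendsto (fun n => eLpNorm f 2 μ * eLpNorm (fun x => h n x - g x) 2 μ) atTop (𝓝 0) := by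
    simpa using ENNReal.Tendsto.const_mul hlim (Or.inr hf.eLpNorm_ne_top)
  have hz' : Tendsto (fun n => eLpNorm (fun x => (inner ℝ (f x) (h n x - g x) : ℝ)) 1 μ)
      atTop (𝓝 0) := by
    refine tendsto_of_tendsto_of_tendsto_of_le_of_le tendsto_const_nhds hz (fun _ => zero_le) ?_
    intro n
    exact eLpNorm_inner_le hf.1 ((hh n).1.sub hg.1)
  refine tendsto_integral_of_L1' (fun x => (inner ℝ (f x) (g x) : ℝ))
    (F := fun n x => (inner ℝ (f x) (h n x) : ℝ)) (integrable_inner_of_memLp hf hg).1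
    (Eventually.of_forall fun n => integrable_inner_of_memLp hf (hh n)) ?_
  simp_rw [inner_sub_right] at hz'
  exact hz'

theorem memLp_smul_of_bounded {α E : Type*} [MeasurableSpace α] {μ : Measure α}
    [NormedAddCommGroup E] [NormedSpace ℝ E] {a : α → ℝ} {f : α → E} {A : ℝ}
    (ha : Measurable a) (ha_le : ∀ x, |a x| ≤ A) (hf : MemLp f 2 μ) :
    MemLp (fun x => a x • f x) 2 μ := by
  refine MemLp.of_le_mul (c := A) hf (ha.aestronglyMeasurable.smul hf.1) ?_
  filter_upwards with x
  rw [norm_smul]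
  gcongr
  exact ha_le x

/-- The expansion of `0 ≤ ∫ a ‖f - t g‖²`. -/
theorem weighted_quadratic_nonneg {α E : Type*} [MeasurableSpace α] {μ : Measure α}
    [NormedAddCommGroup E] [InnerProductSpace ℝ E] {a : α → ℝ} {f g : α → E} {A : ℝ}
    (ha : Measurable a) (ha0 : ∀ x, 0 ≤ a x) (ha_le : ∀ x, |a x| ≤ A)
    (hf : MemLp f 2 μ) (hg : MemLp g 2 μ) (t : ℝ) :
    2 * t * ∫ x, inner ℝ (a x • f x) (g x) ∂μ ≤
      ∫ x, inner ℝ (a x • f x) (f x) ∂μ + t ^ 2 * ∫ x, inner ℝ (a x • g x) (g x) ∂μ := by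
  have haf := memLp_smul_of_bounded ha ha_le hf
  have hag := memLp_smul_of_bounded ha ha_le hg
  rw [← integral_const_mul, ← integral_const_mul, ← integral_add
    (integrable_inner_of_memLp haf hf) ((integrable_inner_of_memLp hag hg).const_mul _)]
  apply integral_mono ((integrable_inner_of_memLp haf hg).const_mul _)
    ((integrable_inner_of_memLp haf hf).add ((integrable_inner_of_memLp hag hg).const_mul _))
  intro x
  have h : 0 ≤ a x * inner ℝ (f x - t • g x) (f x - t • g x) :=
    mul_nonneg (ha0 x) real_inner_self_nonneg
  rw [real_inner_sub_sub_self, inner_smul_left, inner_smul_right, inner_smul_right] at h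
  simp only [real_inner_smul_left, conj_trivial, Pi.add_apply] at h ⊢
  nlinarith [h]

/-! ### The energy of a weak solution -/

theorem IsTestFunction.continuous_gradient {ω : Set Plane} {v : Plane → ℝ}
    (hv : IsTestFunction ω v) : Continuous (gradient v) :=
  (InnerProductSpace.toDual ℝ Plane).symm.continuous.comp (hv.smooth.continuous_fderiv (by simp))

theorem IsTestFunction.memLp {ω : Set Plane} {v : Plane → ℝ} (hv : IsTestFunction ω v) :
    MemLp v 2 (volume.restrict ω) :=
  (hv.smooth.continuous.memLp_of_hasCompactSupport hv.hasCompactSupport).restrict ω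

theorem IsTestFunction.memLp_gradient {ω : Set Plane} {v : Plane → ℝ} (hv : IsTestFunction ω v) :
    MemLp (gradient v) 2 (volume.restrict ω) := by
  refine MemLp.restrict ω (hv.continuous_gradient.memLp_of_hasCompactSupport ?_)
  exact (hv.hasCompactSupport.fderiv ℝ).comp_left (map_zero (InnerProductSpace.toDual ℝ Plane).symm)

/-- The dual characterization of the energy of a weak solution `u`. Approximation by test functions
allows `u` itself in the weak formulation, so `∫ a f u` is the energy `B(u, u)`; expanding
`B(u - t v, u - t v) ≥ 0` gives the bound. Here `A` is any bound on the weight. -/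
theorem IsWeakSolution.energy_lower_bound {ω : Set Plane} {a f u v : Plane → ℝ} {lam A : ℝ}
    (ha : Measurable a) (ha0 : ∀ x, 0 ≤ a x) (ha_le : ∀ x, |a x| ≤ A) (hlam : 0 ≤ lam)
    (hf : MemLp f 2 (volume.restrict ω)) (hu : IsWeakSolution ω a lam f 0 u)
    (hv : IsTestFunction ω v) (t : ℝ) :
    2 * t * ∫ x in ω, a x * f x * v x ≤
      (∫ x in ω, a x * f x * u x) +
        t ^ 2 * ((∫ x in ω, a x * ‖gradient v x‖ ^ 2) + lam * ∫ x in ω, a x * v x ^ 2) := by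
  obtain ⟨G, hG, hweak⟩ := hu
  have haG := memLp_smul_of_bounded ha ha_le hG.memLp_gradient
  have hau := memLp_smul_of_bounded ha ha_le hG.memLp
  have haf := memLp_smul_of_bounded ha ha_le hf
  have hweak' : ∀ w, IsTestFunction ω w →
      (∫ x in ω, inner ℝ (a x • G x) (gradient w x)) + lam * ∫ x in ω, inner ℝ (a x • u x) (w x) =
        ∫ x in ω, inner ℝ (a x • f x) (w x) := by
    intro w hw
    rw [← integral_const_mul, ← integral_add (integrable_inner_of_memLp haG hw.memLp_gradient)
      ((integrable_inner_of_memLp hau hw.memLp).const_mul _)]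
    refine Eq.trans (integral_congr_ae ?_) ((hweak w hw).trans (integral_congr_ae ?_))
    · filter_upwards with x
      rw [real_inner_smul_left, real_inner_smul_left, RCLike.inner_apply, conj_trivial]
      ring
    · filter_upwards with x
      rw [real_inner_smul_left, RCLike.inner_apply, conj_trivial, Pi.zero_apply, inner_zero_left]
      ring
  obtain ⟨ψ, hψ, hψu, hψG⟩ := hG.approx
  have henergy : (∫ x in ω, inner ℝ (a x • G x) (G x)) + lam * ∫ x in ω, inner ℝ (a x • u x) (u x) =
      ∫ x in ω, inner ℝ (a x • f x) (u x) := by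
    refine tendsto_nhds_unique ?_ (tendsto_integral_inner haf hG.memLp (fun n => (hψ n).memLp) hψu)
    simp_rw [← fun n => hweak' (ψ n) (hψ n)]
    exact (tendsto_integral_inner haG hG.memLp_gradient (fun n => (hψ n).memLp_gradient) hψG).add
      ((tendsto_integral_inner hau hG.memLp (fun n => (hψ n).memLp) hψu).const_mul lam)
  have q1 := weighted_quadratic_nonneg ha ha0 ha_le hG.memLp_gradient hv.memLp_gradient t
  have q2 := mul_le_mul_of_nonneg_left
    (weighted_quadratic_nonneg ha ha0 ha_le hG.memLp hv.memLp t) hlam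
  have q3 := hweak' v hv
  have e1 : ∀ w : Plane → ℝ, ∫ x in ω, inner ℝ (a x • f x) (w x) = ∫ x in ω, a x * f x * w x := by
    intro w
    congr 1 with x
    simp only [smul_eq_mul, RCLike.inner_apply, conj_trivial]
    ring
  have e2 : ∫ x in ω, inner ℝ (a x • gradient v x) (gradient v x) =
      ∫ x in ω, a x * ‖gradient v x‖ ^ 2 := by
    congr 1 with x
    rw [real_inner_smul_left, real_inner_self_eq_norm_sq]
  have e3 : ∫ x in ω, inner ℝ (a x • v x) (v x) = ∫ x in ω, a x * v x ^ 2 := by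
    congr 1 with x
    simp only [smul_eq_mul, RCLike.inner_apply, conj_trivial]
    ring
  rw [e1] at q3 henergy
  rw [e2] at q1
  rw [e3] at q2
  rw [← q3, ← henergy]
  nlinarith [q1, q2]

/-! ### Geometry of the discs and the conductivity -/

theorem disc_zero (ε r : ℝ) : disc ε r 0 0 = Metric.ball (0 : Plane) (ε * r) := by
  have : (!₂[((0 : ℤ) : ℝ) * ε, ((0 : ℤ) : ℝ) * ε] : Plane) = 0 := by
    ext i
    fin_cases i <;> simp
  rw [disc, this]

theorem mem_disc_zero {ε r : ℝ} {x : Plane} : x ∈ disc ε r 0 0 ↔ ‖x‖ < ε * r := by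
  rw [disc_zero, mem_ball_zero_iff]

theorem measurableSet_disc_zero (ε r : ℝ) : MeasurableSet (disc ε r 0 0) := by
  rw [disc_zero]
  exact measurableSet_ball

theorem volume_real_ball {R : ℝ} (hR : 0 ≤ R) :
    volume.real (Metric.ball (0 : Plane) R) = Real.pi * R ^ 2 := by
  rw [measureReal_def, EuclideanSpace.volume_ball_fin_two, ENNReal.toReal_mul, ENNReal.toReal_pow,
    ENNReal.toReal_ofReal hR, ENNReal.toReal_ofReal Real.pi_pos.le, mul_comm]

/-- Within the distance `ε²` of the origin there is no disc of the lattice but the central one. -/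
theorem eq_zero_of_mem_disc {ε r : ℝ} (hε : 0 < ε) (hr : r ≤ 1 - ε) {m n : ℤ} {x : Plane}
    (hx : ‖x‖ ≤ ε ^ 2) (hmem : x ∈ disc ε r m n) : m = 0 ∧ n = 0 := by
  rw [disc, Metric.mem_ball, dist_eq_norm] at hmem
  set c : Plane := !₂[(m : ℝ) * ε, (n : ℝ) * ε] with hc
  have hnorm : ‖c‖ < ε := by
    have h1 : ‖c‖ ≤ ‖x‖ + ‖x - c‖ := by
      rw [norm_sub_rev]
      exact norm_le_insert' c x
    nlinarith
  have key : ∀ k : ℤ, |(k : ℝ) * ε| < ε → k = 0 := by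
    intro k hk
    rw [abs_mul, abs_of_pos hε] at hk
    have h2 : |(k : ℝ)| < 1 := by
      by_contra! h
      nlinarith
    rw [← Int.abs_lt_one_iff]
    exact_mod_cast h2
  exact ⟨key m ((PiLp.norm_apply_le c 0).trans_lt hnorm),
    key n ((PiLp.norm_apply_le c 1).trans_lt hnorm)⟩

theorem isOpen_fibres (ω₀ : Set Plane) (ε r : ℝ) : IsOpen (fibres ω₀ ε r) :=
  isOpen_biUnion fun _ _ => Metric.isOpen_ball

theorem measurable_conductivity (ω₀ : Set Plane) (ε r α : ℝ) :
    Measurable (conductivity ω₀ ε r α) := by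
  classical
  exact Measurable.ite (isOpen_fibres ω₀ ε r).measurableSet measurable_const measurable_const

theorem conductivity_nonneg (ω₀ : Set Plane) {ε r α : ℝ} (hα : 0 ≤ α) (x : Plane) :
    0 ≤ conductivity ω₀ ε r α x := by
  unfold conductivity
  split_ifs <;> linarith

theorem abs_conductivity_le (ω₀ : Set Plane) {ε r α : ℝ} (hα : 0 ≤ α) (x : Plane) :
    |conductivity ω₀ ε r α x| ≤ max α 1 := by
  rw [abs_of_nonneg (conductivity_nonneg ω₀ hα x)]
  unfold conductivity
  split_ifs
  · exact le_max_left _ _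
  · exact le_max_right _ _

theorem conductivity_of_mem_disc {ω₀ : Set Plane} {ε r α : ℝ} (h : disc ε r 0 0 ⊆ ω₀) {x : Plane}
    (hx : x ∈ disc ε r 0 0) : conductivity ω₀ ε r α x = α :=
  if_pos (Set.mem_biUnion (x := ((0 : ℤ), (0 : ℤ))) h hx)

theorem conductivity_of_annulus {ω₀ : Set Plane} {ε r α : ℝ} (hε : 0 < ε) (hr : r ≤ 1 - ε)
    {x : Plane} (hx : ‖x‖ ∈ Set.Icc (ε * r) (ε ^ 2)) : conductivity ω₀ ε r α x = 1 := by
  refine if_neg fun hmem => ?_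
  obtain ⟨⟨m, n⟩, -, hmn⟩ := Set.mem_iUnion₂.1 hmem
  obtain ⟨rfl, rfl⟩ := eq_zero_of_mem_disc hε hr hx.2 hmn
  exact absurd (mem_disc_zero.1 hmn) (not_lt.2 hx.1)

/-! ### Pairings with the source -/

theorem conductivity_mul_source {ω₀ : Set Plane} {ε r α : ℝ} (h : disc ε r 0 0 ⊆ ω₀) (x : Plane) :
    conductivity ω₀ ε r α x * source ε r x = (disc ε r 0 0).indicator (fun _ => α * ε⁻¹) x := by
  by_cases hx : x ∈ disc ε r 0 0
  · simp [source, hx, conductivity_of_mem_disc h hx]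
  · simp [source, hx]

theorem memLp_source (ω : Set Plane) (ε r : ℝ) : MemLp (source ε r) 2 (volume.restrict ω) := by
  refine MemLp.restrict ω (memLp_indicator_const 2 (measurableSet_disc_zero ε r) _ (Or.inr ?_))
  rw [disc_zero]
  exact measure_ball_lt_top.ne

/-- The square of the norm is at most `α ε⁻² · π (ε r)² = α π r²`. -/
theorem eLpNorm_source_le {ω ω₀ : Set Plane} {ε r α κ : ℝ} (hε : 0 < ε)
    (hr : 0 ≤ r) (hα : 0 ≤ α) (hκ : α * (Real.pi * r ^ 2) ≤ κ) (h : disc ε r 0 0 ⊆ ω₀) :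
    eLpNorm (fun x => √(conductivity ω₀ ε r α x) * source ε r x) 2 (volume.restrict ω) ≤
      ENNReal.ofReal √κ := by
  have hfun : (fun x => √(conductivity ω₀ ε r α x) * source ε r x) =
      (disc ε r 0 0).indicator fun _ => √α * ε⁻¹ := by
    ext x
    by_cases hx : x ∈ disc ε r 0 0
    · simp [source, hx, conductivity_of_mem_disc h hx]
    · simp [source, hx]
  refine (eLpNorm_mono_measure _ Measure.restrict_le_self).trans ?_
  rw [hfun, eLpNorm_indicator_const (measurableSet_disc_zero ε r) two_ne_zero ENNReal.ofNat_ne_top,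
    disc_zero, ← ofReal_measureReal measure_ball_lt_top.ne, volume_real_ball (by positivity),
    Real.enorm_of_nonneg (by positivity), ENNReal.toReal_ofNat,
    ENNReal.ofReal_rpow_of_nonneg (by positivity) (by norm_num),
    ← ENNReal.ofReal_mul (by positivity), ← Real.sqrt_eq_rpow]
  apply ENNReal.ofReal_le_ofReal
  apply Real.le_sqrt_of_sq_le
  refine le_trans (le_of_eq ?_) hκ
  rw [mul_pow, mul_pow, Real.sq_sqrt hα, Real.sq_sqrt (by positivity)]
  field_simp

theorem setIntegral_conductivity_mul_source {ω ω₀ : Set Plane} {ε r α : ℝ} {v : Plane → ℝ}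
    (hε : 0 < ε) (hr : 0 ≤ r) (h : disc ε r 0 0 ⊆ ω₀) (hω : ω₀ ⊆ ω)
    (hv : ∀ x, ‖x‖ < ε * r → v x = 1) :
    ∫ x in ω, conductivity ω₀ ε r α x * source ε r x * v x = ε * (α * (Real.pi * r ^ 2)) := by
  have hfun : (fun x => conductivity ω₀ ε r α x * source ε r x * v x) =
      (disc ε r 0 0).indicator fun _ => α * ε⁻¹ := by
    ext x
    rw [conductivity_mul_source h]
    by_cases hx : x ∈ disc ε r 0 0
    · simp [hx, hv x (mem_disc_zero.1 hx)]
    · simp [hx]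
  rw [hfun, integral_indicator (measurableSet_disc_zero ε r),
    Measure.restrict_restrict (measurableSet_disc_zero ε r),
    Set.inter_eq_self_of_subset_left (h.trans hω), setIntegral_const, disc_zero,
    volume_real_ball (by positivity), smul_eq_mul]
  field_simp

theorem setIntegral_conductivity_mul_source_le {ω ω₀ : Set Plane} {ε r α : ℝ} {u : Plane → ℝ}
    (hε : 0 < ε) (hr : 0 ≤ r) (hα : 0 ≤ α) (h : disc ε r 0 0 ⊆ ω₀) (hω : ω₀ ⊆ ω)
    (hu : eLpNorm u ⊤ (volume.restrict ω) ≠ ⊤) :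
    ∫ x in ω, conductivity ω₀ ε r α x * source ε r x * u x ≤
      ε * (α * (Real.pi * r ^ 2)) * (eLpNorm u ⊤ (volume.restrict ω)).toReal := by
  set M := (eLpNorm u ⊤ (volume.restrict ω)).toReal with hM
  have hbound : ∀ᵐ x ∂volume.restrict ω, ‖u x‖ ≤ M := by
    rw [eLpNorm_exponent_top] at hu hM
    filter_upwards [ae_le_eLpNormEssSup (f := u) (μ := volume.restrict ω)] with x hx
    rw [hM, ← toReal_enorm]
    exact ENNReal.toReal_mono hu hx
  have hint : Integrable ((disc ε r 0 0).indicator fun _ => α * ε⁻¹) (volume.restrict ω) := by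
    rw [integrable_indicator_iff (measurableSet_disc_zero ε r)]
    refine (integrableOn_const ?_).restrict
    rw [disc_zero]
    exact measure_ball_lt_top.ne
  refine (Real.le_norm_self _).trans
    ((norm_integral_le_of_norm_le (hint.mul_const M) ?_).trans_eq ?_)
  · filter_upwards [hbound] with x hx
    rw [conductivity_mul_source h, norm_mul]
    have h0 : 0 ≤ (disc ε r 0 0).indicator (fun _ => α * ε⁻¹) x :=
      Set.indicator_nonneg (fun _ _ => by positivity) x
    rw [Real.norm_of_nonneg h0]
    gcongr
  · rw [integral_mul_const, integral_indicator (measurableSet_disc_zero ε r),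
      Measure.restrict_restrict (measurableSet_disc_zero ε r),
      Set.inter_eq_self_of_subset_left (h.trans hω), setIntegral_const, disc_zero,
      volume_real_ball (by positivity), smul_eq_mul]
    field_simp

/-! ### The energy of the logarithmic cutoff -/

/-- The logarithmic cutoff between the radii `ε r` and `ε²` as a test function. It equals `1` on the
central disc and its support meets no other disc, so its gradient only sees the conductivity `1`.
The outer radius `ε²` makes the contribution of the annulus to the mass term negligible against `ε²`
while changing the logarithm of the ratio of the radii only by `log ε`. -/
theorem exists_testFunction_energy_le {ω ω₀ : Set Plane} {ε r α : ℝ}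
    (hω₀ : ω₀ ⊆ ω) (hball : Metric.closedBall 0 (ε ^ 2) ⊆ ω₀)
    (hε : 0 < ε) (hr : 0 < r) (hr1 : r ≤ 1 - ε) (hα : 0 ≤ α)
    (hL : 2 < Real.log ε - Real.log r) :
    ∃ v : Plane → ℝ, IsTestFunction ω v ∧ (∀ x, ‖x‖ < ε * r → v x = 1) ∧
      ∫ x in ω, conductivity ω₀ ε r α x * ‖gradient v x‖ ^ 2 ≤
        2 * Real.pi * ((Real.log ε - Real.log r) / (Real.log ε - Real.log r - 2) ^ 2) ∧
      ∫ x in ω, conductivity ω₀ ε r α x * v x ^ 2 ≤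
        ε ^ 2 * (α * (Real.pi * r ^ 2)) + Real.pi * ε ^ 4 := by
  have hlog : Real.log (ε ^ 2) - Real.log (ε * r) = Real.log ε - Real.log r := by
    rw [Real.log_pow, Real.log_mul hε.ne' hr.ne']
    push_cast
    ring
  have hρ : 0 < ε * r := by positivity
  have hR : 0 < ε ^ 2 := by positivity
  obtain ⟨v, hv, hv1, hv0, hv01, hg1, hg0, hg⟩ :=
    exists_log_cutoff hρ (R := ε ^ 2) (by linarith) hR
  have hρR : ε * r ≤ ε ^ 2 := by
    rw [← Real.log_le_log_iff hρ hR]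
    linarith
  have hdisc : disc ε r 0 0 ⊆ ω₀ := by
    rw [disc_zero]
    exact (Metric.ball_subset_closedBall.trans (Metric.closedBall_subset_closedBall hρR)).trans hball
  have hsupp : tsupport v ⊆ Metric.closedBall 0 (ε ^ 2) := by
    refine closure_minimal (fun x hx => ?_) Metric.isClosed_closedBall
    rw [mem_closedBall_zero_iff]
    by_contra! h
    exact hx (hv0 x h.le)
  have hnn := conductivity_nonneg ω₀ (ε := ε) (r := r) hα
  set L := Real.log ε - Real.log r with hLdef
  refine ⟨v, ⟨hv, HasCompactSupport.of_support_subset_isCompact (isCompact_closedBall 0 (ε ^ 2))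
    ((subset_tsupport v).trans hsupp), hsupp.trans (hball.trans hω₀)⟩, hv1, ?_, ?_⟩
  · obtain ⟨hint, hval⟩ := integral_annulus_inv_norm_sq hρ hρR
    have hint' := hint.const_mul (1 / (L - 2) ^ 2)
    calc ∫ x in ω, conductivity ω₀ ε r α x * ‖gradient v x‖ ^ 2
        ≤ ∫ x in ω, 1 / (L - 2) ^ 2 *
            {x : Plane | ‖x‖ ∈ Set.Icc (ε * r) (ε ^ 2)}.indicator (fun x => (‖x‖ ^ 2)⁻¹) x := by
          refine integral_mono_of_nonneg (Eventually.of_forall fun x =>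
            mul_nonneg (hnn x) (sq_nonneg _)) hint'.restrict (Eventually.of_forall fun x => ?_)
          by_cases hx : x ∈ {x : Plane | ‖x‖ ∈ Set.Icc (ε * r) (ε ^ 2)}
          · have hx0 : x ≠ 0 := norm_pos_iff.1 (hρ.trans_le hx.1)
            have := hg x hx0
            rw [hlog] at this
            simp only [Set.indicator_of_mem hx, conductivity_of_annulus hε hr1 hx, one_mul]
            calc ‖gradient v x‖ ^ 2 ≤ (1 / ((L - 2) * ‖x‖)) ^ 2 := by gcongr
              _ = _ := by
                rw [div_pow, mul_pow, one_pow, one_div, one_div, mul_inv]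
          · have hgx : gradient v x = 0 := by
              by_cases h1 : ‖x‖ < ε * r
              · exact hg1 x h1
              · refine hg0 x ?_
                by_contra! h2
                exact hx ⟨not_lt.1 h1, h2⟩
            simp only [hgx, Set.indicator_of_notMem hx, norm_zero]
            simp
      _ ≤ ∫ x, 1 / (L - 2) ^ 2 *
            {x : Plane | ‖x‖ ∈ Set.Icc (ε * r) (ε ^ 2)}.indicator (fun x => (‖x‖ ^ 2)⁻¹) x := by
          refine setIntegral_le_integral hint' (Eventually.of_forall fun x => ?_)
          exact mul_nonneg (by positivity) (Set.indicator_nonneg (fun _ _ => by positivity) x)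
      _ = _ := by
          rw [integral_const_mul, hval, hlog]
          ring
  · have hint : ∀ (R c : ℝ), Integrable ((Metric.ball (0 : Plane) R).indicator fun _ => c) :=
      fun R c => (integrable_indicator_iff measurableSet_ball).2
        (integrableOn_const measure_ball_lt_top.ne)
    have hint' := (hint (ε * r) α).add (hint (ε ^ 2) 1)
    calc ∫ x in ω, conductivity ω₀ ε r α x * v x ^ 2
        ≤ ∫ x in ω, ((Metric.ball (0 : Plane) (ε * r)).indicator (fun _ => α) x +
            (Metric.ball (0 : Plane) (ε ^ 2)).indicator (fun _ => (1 : ℝ)) x) := by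
          refine integral_mono_of_nonneg (Eventually.of_forall fun x =>
            mul_nonneg (hnn x) (sq_nonneg _)) hint'.restrict (Eventually.of_forall fun x => ?_)
          have hvx : v x ^ 2 ≤ 1 := pow_le_one₀ (hv01 x).1 (hv01 x).2
          by_cases h1 : ‖x‖ < ε * r
          · have h2 : ‖x‖ < ε ^ 2 := h1.trans_le hρR
            simp only [Set.indicator, mem_ball_zero_iff, h1, h2, if_true,
              conductivity_of_mem_disc hdisc (mem_disc_zero.2 h1)]
            nlinarith
          · by_cases h2 : ‖x‖ < ε ^ 2
            · simpa [Set.indicator, h1, h2,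
                conductivity_of_annulus hε hr1 ⟨not_lt.1 h1, h2.le⟩] using
                  (sq_le_one_iff_abs_le_one _).1 hvx
            · simp [Set.indicator, h1, h2, hv0 x (not_lt.1 h2)]
      _ ≤ ∫ x, ((Metric.ball (0 : Plane) (ε * r)).indicator (fun _ => α) x +
            (Metric.ball (0 : Plane) (ε ^ 2)).indicator (fun _ => (1 : ℝ)) x) := by
          refine setIntegral_le_integral hint' (Eventually.of_forall fun x => ?_)
          exact add_nonneg (Set.indicator_nonneg (fun _ _ => hα) x)
            (Set.indicator_nonneg (fun _ _ => zero_le_one) x)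
      _ = _ := by
          rw [integral_add (hint _ _) (hint _ _), integral_indicator measurableSet_ball,
            integral_indicator measurableSet_ball, setIntegral_const, setIntegral_const,
            volume_real_ball hρ.le, volume_real_ball hR.le, smul_eq_mul, smul_eq_mul]
          ring

/-! ### The supremum of the solution -/

/-- The lower bound on the solution from a bound `ε² D` on the energy of the cutoff. With
`S = α π r²`, the pairing of the source with the cutoff is `ε S` and the energy of `φ` is at most
`ε S ‖φ‖_∞`, so that `(ε S)² ≤ ε S ‖φ‖_∞ · ε² D`. -/
theorem IsWeakSolution.le_eLpNorm_top {ω ω₀ : Set Plane} {ε r α κm lam D : ℝ} {φ : Plane → ℝ}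
    (hω₀ : ω₀ ⊆ ω) (hball : Metric.closedBall 0 (ε ^ 2) ⊆ ω₀)
    (hε : 0 < ε) (hr : 0 < r) (hr1 : r ≤ 1 - ε) (hα : 0 < α) (hlam : 0 ≤ lam)
    (hL : 2 < Real.log ε - Real.log r) (hκ : κm ≤ α * (Real.pi * r ^ 2)) (hD : 0 < D)
    (hQ : 2 * Real.pi * ((Real.log ε - Real.log r) / (Real.log ε - Real.log r - 2) ^ 2) +
      lam * (ε ^ 2 * (α * (Real.pi * r ^ 2)) + Real.pi * ε ^ 4) ≤ ε ^ 2 * D)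
    (hφ : IsWeakSolution ω (conductivity ω₀ ε r α) lam (source ε r) 0 φ) :
    ENNReal.ofReal (1 / ε * (κm / D)) ≤ eLpNorm φ ⊤ (volume.restrict ω) := by
  by_cases htop : eLpNorm φ ⊤ (volume.restrict ω) = ⊤
  · rw [htop]
    exact le_top
  apply ENNReal.ofReal_le_of_le_toReal
  have hdisc : disc ε r 0 0 ⊆ ω₀ := by
    rw [disc_zero]
    refine (Metric.ball_subset_closedBall.trans (Metric.closedBall_subset_closedBall ?_)).trans hball
    -- The gap of the logarithms forces `r < ε`, hence `ε r ≤ ε²`.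
    have hlt : r ≤ ε := ((Real.log_lt_log_iff hr hε).1 (by linarith)).le
    nlinarith
  obtain ⟨v, hv, hv1, hgrad, hmass⟩ := exists_testFunction_energy_le hω₀ hball hε hr hr1 hα.le hL
  set S := α * (Real.pi * r ^ 2) with hS
  have hSpos : 0 < S := by have := Real.pi_pos; positivity
  -- `t = S / (ε D)` maximizes `2 t (ε S) - t² (ε² D)`.
  have hineq := hφ.energy_lower_bound (measurable_conductivity ω₀ ε r α)
    (conductivity_nonneg ω₀ hα.le) (abs_conductivity_le ω₀ hα.le) hlam (memLp_source ω ε r) hv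
    (S / (ε * D))
  rw [setIntegral_conductivity_mul_source hε hr.le hdisc hω₀ hv1] at hineq
  have hup := setIntegral_conductivity_mul_source_le hε hr.le hα.le hdisc hω₀ htop
  set M := (eLpNorm φ ⊤ (volume.restrict ω)).toReal
  have hQ' := (add_le_add hgrad (mul_le_mul_of_nonneg_left hmass hlam)).trans hQ
  have h1 : 2 * (S / (ε * D)) * (ε * S) ≤ ε * S * M + (S / (ε * D)) ^ 2 * (ε ^ 2 * D) :=
    hineq.trans (add_le_add hup (mul_le_mul_of_nonneg_left hQ' (sq_nonneg _)))
  have e1 : 2 * (S / (ε * D)) * (ε * S) = 2 * (S * (S / D)) := by field_simp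
  have e2 : (S / (ε * D)) ^ 2 * (ε ^ 2 * D) = S * (S / D) := by field_simp
  rw [e1, e2] at h1
  have h2 : S / D ≤ ε * M := by
    by_contra! h
    nlinarith
  rw [one_div, ← div_eq_inv_mul, div_le_iff₀ hε, mul_comm M]
  exact le_trans (by gcongr) h2

/-! ### The error term -/

/-- The lower bound on `log (ε² / (ε r)) = log ε - log r` that follows from `2π/γ ≤ -ε² log r`. -/
noncomputable def logGap (γ ε : ℝ) : ℝ :=
  Real.log ε + 2 * Real.pi / (γ * ε ^ 2)

/-- The correction term `o(ε)`: it is chosen so that `ε² (γ + lam κ + o(ε))` is exactly the bound on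
the energy of the cutoff when `log ε - log r` and `α π r²` take their extreme values `logGap γ ε`
and `κ`. -/
noncomputable def energyError (γ lam ε : ℝ) : ℝ :=
  2 * Real.pi * (logGap γ ε / (logGap γ ε - 2) ^ 2) / ε ^ 2 + lam * Real.pi * ε ^ 2 - γ

theorem tendsto_sq_mul_logGap_sub {γ : ℝ} (hγ : 0 < γ) (c : ℝ) :
    Tendsto (fun ε => ε ^ 2 * (logGap γ ε - c)) (𝓝[>] 0) (𝓝 (2 * Real.pi / γ)) := by
  have h1 : Tendsto (fun ε : ℝ => Real.log ε * ε ^ 2) (𝓝[>] 0) (𝓝 0) := by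
    simpa using tendsto_log_mul_rpow_nhdsGT_zero (r := 2) two_pos
  have h2 : Tendsto (fun ε : ℝ => c * ε ^ 2) (𝓝[>] 0) (𝓝 0) := by
    refine tendsto_nhdsWithin_of_tendsto_nhds ?_
    have : Continuous fun ε : ℝ => c * ε ^ 2 := by fun_prop
    simpa using this.tendsto 0
  have h3 := (h1.sub h2).add_const (2 * Real.pi / γ)
  rw [sub_zero, zero_add] at h3
  refine h3.congr' ?_
  filter_upwards [self_mem_nhdsWithin] with ε hε
  have hε' : ε ≠ 0 := (Set.mem_Ioi.1 hε).ne'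
  unfold logGap
  field_simp
  ring

theorem tendsto_energyError {γ : ℝ} (hγ : 0 < γ) (lam : ℝ) :
    Tendsto (energyError γ lam) (𝓝[>] 0) (𝓝 0) := by
  have hpos : 0 < 2 * Real.pi / γ := by have := Real.pi_pos; positivity
  have h1 : Tendsto (fun ε => 2 * Real.pi * (ε ^ 2 * (logGap γ ε - 0) /
      (ε ^ 2 * (logGap γ ε - 2)) ^ 2)) (𝓝[>] 0) (𝓝 γ) := by
    have h := ((tendsto_sq_mul_logGap_sub hγ 0).div ((tendsto_sq_mul_logGap_sub hγ 2).pow 2)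
      (by positivity)).const_mul (2 * Real.pi)
    have e : 2 * Real.pi * (2 * Real.pi / γ / (2 * Real.pi / γ) ^ 2) = γ := by
      have := Real.pi_pos.ne'
      field_simp
    rwa [e] at h
  have h2 : Tendsto (fun ε : ℝ => lam * Real.pi * ε ^ 2) (𝓝[>] 0) (𝓝 0) := by
    refine tendsto_nhdsWithin_of_tendsto_nhds ?_
    have : Continuous fun ε : ℝ => lam * Real.pi * ε ^ 2 := by fun_prop
    simpa using this.tendsto 0
  have h3 := (h1.add h2).sub_const γ
  rw [add_zero, sub_self] at h3
  refine h3.congr' ?_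
  filter_upwards [self_mem_nhdsWithin] with ε hε
  have hε' : ε ≠ 0 := (Set.mem_Ioi.1 hε).ne'
  unfold energyError
  rw [sub_zero, mul_pow, div_eq_mul_inv, mul_inv, div_eq_mul_inv, div_eq_mul_inv]
  congr 2
  field_simp

theorem div_sub_two_sq_anti {p q : ℝ} (hp : 2 < p) (hpq : p ≤ q) :
    q / (q - 2) ^ 2 ≤ p / (p - 2) ^ 2 := by
  have h1 : 0 < p - 2 := by linarith
  have h2 : 0 < q - 2 := by linarith
  rw [div_le_div_iff₀ (by positivity) (by positivity)]
  nlinarith [mul_nonneg (mul_pos h1 h2).le (sub_nonneg.2 hpq), mul_nonneg (add_pos h1 h2).le (sub_nonneg.2 hpq)]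

/-! ### Uniform lower bound for small `ε` -/

theorem Admissible.conductivity_pos {κm κp γm γp ε r α : ℝ} (hκm : 0 < κm)
    (h : Admissible κm κp γm γp ε r α) : 0 < α := by
  have hr := h.r_pos
  have hπ := Real.pi_pos
  exact pos_of_mul_pos_left (hκm.trans_le h.kappa_le) (by positivity)

theorem Admissible.logGap_le {κm κp γm γp ε r α : ℝ} (hε : 0 < ε)
    (h : Admissible κm κp γm γp ε r α) : logGap γp ε ≤ Real.log ε - Real.log r := by
  have h1 : 2 * Real.pi / (γp * ε ^ 2) ≤ - Real.log r := by
    rw [← div_div, div_le_iff₀ (by positivity)]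
    linarith [h.gamma_le]
  unfold logGap
  linarith

/-- The lower bound for all small `ε`, uniformly in `r` and `α`, with positivity of its denominator
and the inclusion of the central disc in `ω₀`. -/
theorem eventually_le_eLpNorm_top {ω ω₀ : Set Plane} (hω₀_open : IsOpen ω₀) (hω₀ : ω₀ ⊆ ω)
    (h_zero : (0 : Plane) ∈ ω₀) {κm κp γm γp lam : ℝ} (hκm : 0 < κm) (hκ : κm ≤ κp)
    (hγp : 0 < γp) (hlam : 0 < lam) :
    ∀ᶠ ε in 𝓝[>] (0 : ℝ), 0 < ε ∧ 0 < γp + lam * κp + energyError γp lam ε ∧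
      ∀ r α : ℝ, Admissible κm κp γm γp ε r α → disc ε r 0 0 ⊆ ω₀ ∧
        ∀ φ : Plane → ℝ,
          IsWeakSolution ω (conductivity ω₀ ε r α) lam (source ε r) 0 φ →
          ENNReal.ofReal (1 / ε * (κm / κp) * (κm / (γp + lam * κp + energyError γp lam ε))) ≤
            eLpNorm φ ⊤ (volume.restrict ω) := by
  have hπ := Real.pi_pos
  have hκp : 0 < κp := hκm.trans_le hκ
  obtain ⟨δ, hδ, hδω⟩ := Metric.isOpen_iff.1 hω₀_open 0 h_zero
  have hsq : ∀ᶠ ε : ℝ in 𝓝[>] 0, ε ^ 2 < δ := by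
    have : Tendsto (fun ε : ℝ => ε ^ 2) (𝓝[>] 0) (𝓝 0) := by
      refine tendsto_nhdsWithin_of_tendsto_nhds ?_
      simpa using (continuous_pow (M := ℝ) 2).tendsto 0
    exact this.eventually_lt_const hδ
  have hgap := (tendsto_sq_mul_logGap_sub hγp 2).eventually_const_lt
    (show 0 < 2 * Real.pi / γp by positivity)
  have hhalf : ∀ᶠ ε : ℝ in 𝓝[>] 0, ε < 1 / 2 :=
    nhdsWithin_le_nhds (eventually_lt_nhds (by norm_num))
  filter_upwards [self_mem_nhdsWithin, hsq, hgap, hhalf] with ε (hε : 0 < ε) hεδ hεgap hε2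
  have hgap2 : 2 < logGap γp ε := by
    have := pos_of_mul_pos_right hεgap (by positivity)
    linarith
  have hD : 0 < γp + lam * κp + energyError γp lam ε := by
    unfold energyError
    have : 0 ≤ 2 * Real.pi * (logGap γp ε / (logGap γp ε - 2) ^ 2) / ε ^ 2 := by positivity
    have : 0 < lam * κp := by positivity
    have : 0 < lam * Real.pi * ε ^ 2 := by positivity
    linarith
  refine ⟨hε, hD, fun r α hadm => ?_⟩
  have hLge := hadm.logGap_le hε
  have hr := hadm.r_pos
  have hrε : r < ε := (Real.log_lt_log_iff hr hε).1 (by linarith)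
  have hball : Metric.closedBall 0 (ε ^ 2) ⊆ ω₀ := (Metric.closedBall_subset_ball hεδ).trans hδω
  refine ⟨?_, fun φ hφ => ?_⟩
  · rw [disc_zero]
    refine (Metric.ball_subset_closedBall.trans (Metric.closedBall_subset_closedBall ?_)).trans hball
    nlinarith
  · refine le_trans (ENNReal.ofReal_le_ofReal ?_) (hφ.le_eLpNorm_top hω₀ hball hε hr (by linarith)
      (hadm.conductivity_pos hκm) hlam.le (by linarith) hadm.kappa_le hD ?_)
    · rw [mul_assoc]
      have : κm / κp ≤ 1 := (div_le_one hκp).2 hκ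
      have h0 : 0 ≤ κm / (γp + lam * κp + energyError γp lam ε) := by positivity
      gcongr
      exact mul_le_of_le_one_left h0 this
    · have hanti := div_sub_two_sq_anti hgap2 hLge
      have e : ε ^ 2 * (γp + lam * κp + energyError γp lam ε) =
          2 * Real.pi * (logGap γp ε / (logGap γp ε - 2) ^ 2) +
            lam * (ε ^ 2 * κp + Real.pi * ε ^ 4) := by
        unfold energyError
        field_simp
        ring
      rw [e]
      have := hadm.le_kappa
      gcongr

end FibredMedium

theorem proposition4 (ω ω₀ : Set FibredMedium.Plane)
    (hω_open : IsOpen ω) (hω_conn : IsConnected ω) (hω_bdd : Bornology.IsBounded ω)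
    (hω₀_open : IsOpen ω₀) (hω₀_compact : IsCompact (closure ω₀)) (hω₀_sub : closure ω₀ ⊆ ω)
    (h_zero : (0 : FibredMedium.Plane) ∈ ω₀)
    (κm κp γm γp lam : ℝ) (hκm : 0 < κm) (hκ : κm ≤ κp) (hγm : 0 < γm) (hγ : γm ≤ γp)
    (hlam : 0 < lam) :
    -- the norm of the source term
    (∀ ε r α : ℝ, 0 < ε → FibredMedium.Admissible κm κp γm γp ε r α →
      FibredMedium.disc ε r 0 0 ⊆ ω₀ →
      eLpNorm (fun x => √(FibredMedium.conductivity ω₀ ε r α x) * FibredMedium.source ε r x) 2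
        (volume.restrict ω) ≤ ENNReal.ofReal √κp) ∧
    -- the lower bound on the solution
    (∃ o : ℝ → ℝ, Tendsto o (𝓝[>] 0) (𝓝 0) ∧
      ∀ᶠ ε in 𝓝[>] (0 : ℝ), ∀ r α : ℝ, FibredMedium.Admissible κm κp γm γp ε r α →
        ∀ φ : FibredMedium.Plane → ℝ,
          FibredMedium.IsWeakSolution ω (FibredMedium.conductivity ω₀ ε r α) lam
            (FibredMedium.source ε r) 0 φ →
          ENNReal.ofReal (1 / ε * (κm / κp) * (κm / (γp + lam * κp + o ε))) ≤
            eLpNorm φ ⊤ (volume.restrict ω)) ∧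
    -- the factor in a supremum estimate is at least of order `1 / ε`
    (∃ c : ℝ, 0 < c ∧
      ∀ᶠ ε in 𝓝[>] (0 : ℝ), ∀ r α : ℝ, FibredMedium.Admissible κm κp γm γp ε r α →
        ∀ φ : FibredMedium.Plane → ℝ,
          FibredMedium.IsWeakSolution ω (FibredMedium.conductivity ω₀ ε r α) lam
            (FibredMedium.source ε r) 0 φ →
          ∀ K : ℝ, eLpNorm φ ⊤ (volume.restrict ω) ≤ ENNReal.ofReal K *
              eLpNorm (fun x => √(FibredMedium.conductivity ω₀ ε r α x) *
                FibredMedium.source ε r x) 2 (volume.restrict ω) →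
            c / ε ≤ K) := by
  have hκp : 0 < κp := hκm.trans_le hκ
  have hγp : 0 < γp := hγm.trans_le hγ
  have hsource : ∀ ε r α : ℝ, 0 < ε → FibredMedium.Admissible κm κp γm γp ε r α →
      FibredMedium.disc ε r 0 0 ⊆ ω₀ →
      eLpNorm (fun x => √(FibredMedium.conductivity ω₀ ε r α x) * FibredMedium.source ε r x) 2
        (volume.restrict ω) ≤ ENNReal.ofReal √κp := fun ε r α hε hadm hdisc =>
    FibredMedium.eLpNorm_source_le hε hadm.r_pos.le (hadm.conductivity_pos hκm).le hadm.le_kappa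
      hdisc
  have hmain := FibredMedium.eventually_le_eLpNorm_top (γm := γm) hω₀_open
    (subset_closure.trans hω₀_sub) h_zero hκm hκ hγp hlam
  have hlim := FibredMedium.tendsto_energyError hγp lam
  refine ⟨hsource, ⟨FibredMedium.energyError γp lam, hlim, ?_⟩, ?_⟩
  · filter_upwards [hmain] with ε h r α hadm
    exact (h.2.2 r α hadm).2
  · have hB : 0 < γp + lam * κp := by positivity
    refine ⟨κm / κp * (κm / (2 * (γp + lam * κp))) / √κp, by positivity, ?_⟩
    filter_upwards [hmain, hlim.eventually_lt_const hB] with ε ⟨hε, hD, h⟩ ho r α hadm φ hφ K hK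
    obtain ⟨hdisc, hlow⟩ := h r α hadm
    have h1 := (hlow φ hφ).trans (hK.trans (mul_le_mul_right (hsource ε r α hε hadm hdisc) _))
    rw [← ENNReal.ofReal_mul' (Real.sqrt_nonneg _)] at h1
    have h2 : 1 / ε * (κm / κp) * (κm / (2 * (γp + lam * κp))) ≤
        1 / ε * (κm / κp) * (κm / (γp + lam * κp + FibredMedium.energyError γp lam ε)) := by
      gcongr
      linarith
    have h3 : 0 < 1 / ε * (κm / κp) * (κm / (2 * (γp + lam * κp))) := by positivity
    -- the left-hand side being positive, `K` cannot be truncated to zero by `ENNReal.ofReal`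
    have h4 := h2.trans ((ENNReal.ofReal_le_ofReal_iff'.1 h1).resolve_right (by linarith))
    rw [div_div, div_le_iff₀ (by positivity)]
    calc κm / κp * (κm / (2 * (γp + lam * κp))) =
        ε * (1 / ε * (κm / κp) * (κm / (2 * (γp + lam * κp)))) := by field_simp
      _ ≤ ε * (K * √κp) := by gcongr
      _ = K * (√κp * ε) := by ring
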